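/- Let $(W,R)$ and $(W',R')$ be Coxeter systems of finite rank, that is, $R=\{r_a\mid a\in\Pi\}$ with $\Pi$ finite, $W=\langle r_a\ (a\in\Pi)\mid (r_ar_b)^{m_{ab}}=1\ (a,b\in\Pi)\rangle$, where $m_{ab}=m_{ba}\in\{1,2,\dots\}\cup\{\infty\}$, $m_{ab}=1$ if and only if $a=b$, and the relation is omitted when $m_{ab}=\infty$; similarly for $(W',R')$. Let $\alpha\colon W\to W'$ be any isomorphism of groups, and let $a\in\Pi$. If $\alpha(r_a)$ is not a reflection of $W'$ (i.e. is not conjugate in $W'$ to an element of $R'$), then $$\mathrm{FC}(r_a)=\bigcap\{F\mid F \text{ is a maximal finite subgroup of } W \text{ with } r_a\in F\}$$ is a parabolic subgroup of $W$ (i.e. $\mathrm{FC}(r_a)=wW_Iw^{-1}$ for some $w\in W$ and $I\subseteq\Pi$, where $W_I=\langle r_b\mid b\in I\rangle$), and it is finite of order greater than $2$. -/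

import Mathlib

/-- A maximal finite subgroup of a group `G`: a finite subgroup that is not properly contained
in any finite subgroup. -/
def IsMaximalFiniteSubgroup {G : Type*} [Group G] (H : Subgroup G) : Prop :=
  Maximal (fun K : Subgroup G => Finite K) H

/-- The finite continuation `FC(w)`: the intersection of all maximal finite subgroups of `G`
containing `w`. -/
def finiteContinuation {G : Type*} [Group G] (w : G) : Subgroup G :=
  sInf {H : Subgroup G | IsMaximalFiniteSubgroup H ∧ w ∈ H}

namespace CoxeterSystem

/-- The visible (standard parabolic) subgroup `W_I` generated by the simple reflections indexed
by `I`. -/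
def visibleSubgroup {B : Type*} {W : Type*} [Group W] {M : CoxeterMatrix B}
    (cs : CoxeterSystem M W) (I : Set B) : Subgroup W :=
  Subgroup.closure (cs.simple '' I)

/-- A parabolic subgroup of `W`: a conjugate `w W_I w⁻¹` of a visible subgroup. -/
def IsParabolic {B : Type*} {W : Type*} [Group W] {M : CoxeterMatrix B}
    (cs : CoxeterSystem M W) (P : Subgroup W) : Prop :=
  ∃ (w : W) (I : Set B), P = (cs.visibleSubgroup I).map (MulAut.conj w).toMonoidHom

end CoxeterSystem

/-!
Every element of finite order in a Coxeter group of finite rank has a finite parabolic finite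
continuation (`CoxeterSystem.isParabolic_finiteContinuation`). The theorem follows by applying this
on both sides of `α`. In `W'`, the finite continuation of `α r_a` is a nontrivial parabolic
subgroup, so it contains a reflection `t`, and `t` differs from `α r_a` by assumption. Finite
continuations are defined by the group structure alone, so `FC(r_a)` contains the three distinct
elements `1`, `r_a` and `α⁻¹ t`.

That finite continuations are parabolic is seen in the Tits cone, in the space of linear functionals
on the geometric representation of `W`. The basis of the whole argument is the sign theorem:
every root has coordinates of one sign, and `w e_i` is negative exactly when `ℓ (w s_i) < ℓ w`
(`CoxeterSystem.geomRep_single_nonneg`, `CoxeterSystem.geomRep_single_nonpos`). Calling `x` a point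
of the Tits cone when it is negative on only finitely many positive roots, one has three facts.

* The stabilizer of a point of the Tits cone is parabolic (`InTitsCone.isParabolic`), because such a
  point has a dominant translate, and the stabilizer of a dominant point is generated by the simple
  reflections it contains.
* A finite subgroup fixes a point of the Tits cone with finite stabilizer, namely an orbit sum of a
  strictly dominant functional (`exists_inTitsCone_of_finite`). So the maximal finite subgroups are
  stabilizers of this kind, and there is one above every finite subgroup.
* The intersection of two stabilizers is the stabilizer of a generic point of the segment between the
  two points (`InTitsCone.exists_inf_eq`), because the Tits cone is convex and `W` is countable.

A finite stabilizer of least order containing `FC(g)` therefore lies in every maximal finite subgroup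
containing `g`, and hence equals `FC(g)`.
-/

/-! ### The geometric representation -/

namespace CoxeterMatrix

variable {B : Type*} (M : CoxeterMatrix B)

/-- The linear functional `2 ⟨e_i, ·⟩` on `B →₀ ℝ`, where `⟨·, ·⟩` is the canonical bilinear form
`⟨e_i, e_j⟩ = -cos (π / m_ij)` of the Coxeter matrix. Mathlib encodes `m_ij = ∞` by `M i j = 0`;
then `π / 0 = 0` gives `⟨e_i, e_j⟩ = -1`, the usual convention. -/
noncomputable def simpleCoroot (i : B) : Module.Dual ℝ (B →₀ ℝ) :=
  Finsupp.linearCombination ℝ fun j => -(2 * Real.cos (Real.pi / M i j))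

lemma simpleCoroot_single (i j : B) :
    M.simpleCoroot i (Finsupp.single j 1) = -(2 * Real.cos (Real.pi / M i j)) := by
  simp [simpleCoroot]

lemma simpleCoroot_single_self (i : B) : M.simpleCoroot i (Finsupp.single i 1) = 2 := by
  simp [simpleCoroot_single]

lemma simpleCoroot_single_comm (i j : B) :
    M.simpleCoroot i (Finsupp.single j 1) = M.simpleCoroot j (Finsupp.single i 1) := by
  rw [simpleCoroot_single, simpleCoroot_single, M.symmetric]

/-- Twice the canonical bilinear form of the Coxeter matrix. -/
noncomputable def canonicalForm : (B →₀ ℝ) →ₗ[ℝ] Module.Dual ℝ (B →₀ ℝ) :=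
  Finsupp.linearCombination ℝ M.simpleCoroot

lemma canonicalForm_single (i : B) :
    M.canonicalForm (Finsupp.single i 1) = M.simpleCoroot i := by
  simp [canonicalForm]

lemma canonicalForm_apply_single (v : B →₀ ℝ) (i : B) :
    M.canonicalForm v (Finsupp.single i 1) = M.simpleCoroot i v := by
  induction v using Finsupp.induction_linear with
  | zero => simp
  | add f g hf hg => simp [hf, hg]
  | single j c =>
    have h : Finsupp.single j c = c • Finsupp.single j (1 : ℝ) := by simp
    rw [h, map_smul, map_smul, LinearMap.smul_apply, canonicalForm_single,
      simpleCoroot_single_comm]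

/-- The orthogonal reflection in the basis vector `e_i`. -/
noncomputable def simpleReflection (i : B) : (B →₀ ℝ) ≃ₗ[ℝ] (B →₀ ℝ) :=
  Module.reflection (M.simpleCoroot_single_self i)

lemma simpleReflection_apply (i : B) (v : B →₀ ℝ) :
    M.simpleReflection i v = v - M.simpleCoroot i v • Finsupp.single i 1 :=
  Module.reflection_apply _ _

/-- The simple reflections satisfy the Coxeter relations: `r_i r_j` is a rotation by `2π / m_ij`
on the plane spanned by `e_i` and `e_j`. -/
lemma isLiftable_simpleReflection : M.IsLiftable M.simpleReflection := by
  intro i j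
  apply LinearEquiv.ext
  intro z
  rcases Nat.lt_trichotomy (M i j) 1 with h | h | h
  · obtain rfl | h0 : i = j ∨ M i j = 0 := Or.inr (by omega)
    · simp at h
    · simp [h0]
  · have hij : i = j := by
      by_contra hne
      exact M.off_diagonal i j hne h
    subst hij
    rw [h, pow_one, LinearEquiv.mul_apply, simpleReflection]
    exact Module.involutive_reflection (M.simpleCoroot_single_self i) z
  · set θ : ℝ := Real.pi / M i j with hθ
    have ht : (2 * Real.cos (2 * θ)) = M.simpleCoroot i (Finsupp.single j 1) *
        M.simpleCoroot j (Finsupp.single i 1) - 2 := by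
      rw [simpleCoroot_single, M.simpleCoroot_single, M.symmetric j i, Real.cos_two_mul]
      ring
    have hm0 : (M i j : ℝ) ≠ 0 := by positivity
    have hmθ : (M i j : ℝ) * θ = Real.pi := by rw [hθ]; field_simp
    rw [simpleReflection, simpleReflection, Module.reflection_mul_reflection_pow_apply _ _ _ _ _ ht]
    rcases Nat.lt_or_ge 2 (M i j) with h3 | h2
    · have hsin : Real.sin (2 * θ) ≠ 0 := by
        apply ne_of_gt
        have hpos := Real.pi_pos
        have h3' : (3 : ℝ) ≤ M i j := by exact_mod_cast h3
        have hθpos : 0 < θ := by positivity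
        apply Real.sin_pos_of_pos_of_lt_pi (by linarith)
        nlinarith
      have hS := fun n : ℤ => Polynomial.Chebyshev.S_two_mul_real_cos (2 * θ) n
      obtain ⟨k, hk | hk⟩ := Nat.even_or_odd' (M i j)
      · have e1 : ((M i j : ℤ) - 2) / 2 = k - 1 := by omega
        have e2 : ((M i j : ℤ) - 1) / 2 = k - 1 := by omega
        have hz : (Polynomial.Chebyshev.S ℝ ((k : ℤ) - 1)).eval (2 * Real.cos (2 * θ)) = 0 := by
          have := hS (k - 1)
          have e : (((k : ℤ) - 1 : ℤ) + 1 : ℝ) * (2 * θ) = Real.pi := by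
            rw [← hmθ, hk]; push_cast; ring
          rw [e, Real.sin_pi] at this
          exact (mul_eq_zero.1 this).resolve_right hsin
        rw [e1, e2, hz]
        simp
      · have e1 : ((M i j : ℤ) - 2) / 2 = k - 1 := by omega
        have e2 : ((M i j : ℤ) - 1) / 2 = k := by omega
        have e3 : ((M i j : ℤ) - 3) / 2 = k - 1 := by omega
        have e4 : (M i j : ℤ) / 2 = k := by omega
        have hz : (Polynomial.Chebyshev.S ℝ (k : ℤ)).eval (2 * Real.cos (2 * θ)) +
            (Polynomial.Chebyshev.S ℝ ((k : ℤ) - 1)).eval (2 * Real.cos (2 * θ)) = 0 := by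
          have h1 := hS k
          have h2 := hS (k - 1)
          have e : (((k : ℤ) : ℝ) + 1) * (2 * θ) =
              2 * Real.pi - ((((k : ℤ) - 1 : ℤ) : ℝ) + 1) * (2 * θ) := by
            rw [← hmθ, hk]; push_cast; ring
          rw [e, Real.sin_two_pi_sub] at h1
          have : ((Polynomial.Chebyshev.S ℝ (k : ℤ)).eval (2 * Real.cos (2 * θ)) +
            (Polynomial.Chebyshev.S ℝ ((k : ℤ) - 1)).eval (2 * Real.cos (2 * θ))) *
              Real.sin (2 * θ) = 0 := by rw [add_mul, h1, h2]; ring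
          exact (mul_eq_zero.1 this).resolve_right hsin
        rw [e1, e2, e3, e4, hz]
        simp
    · -- For `m_ij = 2` the two reflections commute; here `sin (2θ) = 0`, so the general
      -- evaluation of the Chebyshev polynomials does not apply.
      have h2 : M i j = 2 := by omega
      have hc : Real.cos (2 * θ) = -1 := by
        rw [hθ, h2]; push_cast; rw [mul_div_cancel₀ _ two_ne_zero, Real.cos_pi]
      have hc' : M.simpleCoroot i (Finsupp.single j 1) = 0 := by
        simp [simpleCoroot_single, h2]
      have hc'' : M.simpleCoroot j (Finsupp.single i 1) = 0 := by
        rw [← simpleCoroot_single_comm, hc']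
      rw [hc, hc', hc'', h2]
      norm_num
      module

end CoxeterMatrix

namespace CoxeterSystem

variable {B W : Type*} [Group W] {M : CoxeterMatrix B} (cs : CoxeterSystem M W)

/-- The geometric (Tits) representation of a Coxeter group on `B →₀ ℝ`. -/
noncomputable def geomRep : W →* ((B →₀ ℝ) ≃ₗ[ℝ] (B →₀ ℝ)) :=
  cs.lift ⟨M.simpleReflection, M.isLiftable_simpleReflection⟩

lemma geomRep_simple (i : B) : cs.geomRep (cs.simple i) = M.simpleReflection i :=
  cs.lift_apply_simple M.isLiftable_simpleReflection i

lemma geomRep_simple_apply (i : B) (v : B →₀ ℝ) :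
    cs.geomRep (cs.simple i) v = v - M.simpleCoroot i v • Finsupp.single i 1 := by
  rw [geomRep_simple, M.simpleReflection_apply]

lemma geomRep_mul_apply (w w' : W) (v : B →₀ ℝ) :
    cs.geomRep (w * w') v = cs.geomRep w (cs.geomRep w' v) := by
  rw [map_mul]; rfl

lemma geomRep_one_apply (v : B →₀ ℝ) : cs.geomRep 1 v = v := by
  rw [map_one]; rfl

lemma geomRep_apply_inv_self (w : W) (v : B →₀ ℝ) :
    cs.geomRep w (cs.geomRep w⁻¹ v) = v := by
  rw [← geomRep_mul_apply, mul_inv_cancel, geomRep_one_apply]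

lemma geomRep_simple_single_self (i : B) :
    cs.geomRep (cs.simple i) (Finsupp.single i 1) = -Finsupp.single i 1 := by
  rw [geomRep_simple_apply, M.simpleCoroot_single_self]
  module

lemma canonicalForm_geomRep (w : W) (u v : B →₀ ℝ) :
    M.canonicalForm (cs.geomRep w u) (cs.geomRep w v) = M.canonicalForm u v := by
  induction w using cs.simple_induction_left with
  | one => simp
  | mul_simple_left w i ih =>
    rw [geomRep_mul_apply, geomRep_mul_apply, ← ih, geomRep_simple_apply, geomRep_simple_apply]
    simp only [map_sub, map_smul, LinearMap.sub_apply, LinearMap.smul_apply,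
      M.canonicalForm_single, M.canonicalForm_apply_single, M.simpleCoroot_single_self, smul_eq_mul]
    ring

end CoxeterSystem

/-! ### Every root is positive or negative -/

namespace CoxeterSystem

variable {B W : Type*} [Group W] {M : CoxeterMatrix B} (cs : CoxeterSystem M W)

open Polynomial.Chebyshev in
/-- An alternating word in `i` and `j` ending with `j` sends `e_i` to a combination of `e_i` and
`e_j` whose coefficients are consecutive values of the Chebyshev polynomials `S`. -/
lemma geomRep_alternatingWord_single (i j : B) (k : ℕ) :
    cs.geomRep (cs.wordProd (alternatingWord i j k)) (Finsupp.single i 1) =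
      (S ℝ k).eval (2 * Real.cos (Real.pi / M i j)) •
          Finsupp.single (if Even k then i else j) (1 : ℝ) +
        (S ℝ ((k : ℤ) - 1)).eval (2 * Real.cos (Real.pi / M i j)) •
          Finsupp.single (if Even k then j else i) (1 : ℝ) := by
  induction k with
  | zero => simp [alternatingWord]
  | succ k ih =>
    have hS : (S ℝ ((k : ℤ) + 1)).eval (2 * Real.cos (Real.pi / M i j)) =
        2 * Real.cos (Real.pi / M i j) * (S ℝ k).eval (2 * Real.cos (Real.pi / M i j)) -
          (S ℝ ((k : ℤ) - 1)).eval (2 * Real.cos (Real.pi / M i j)) := by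
      rw [S_add_one]; simp
    rw [alternatingWord_succ', wordProd_cons, geomRep_mul_apply, ih, geomRep_simple_apply]
    push_cast
    rw [hS, add_sub_cancel_right]
    by_cases hk : Even k
    · simp only [hk, Nat.even_add_one, if_true, not_true, if_false, map_add, map_smul,
        M.simpleCoroot_single_self, M.simpleCoroot_single, M.symmetric j i]
      module
    · simp only [hk, Nat.even_add_one, if_true, not_false_eq_true, if_false, map_add, map_smul,
        M.simpleCoroot_single_self, M.simpleCoroot_single]
      module

lemma eval_chebyshevS_nonneg {m : ℕ} (hm : m ≠ 1) {n : ℤ} (hn : -1 ≤ n) (hnm : m ≠ 0 → n < m) :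
    0 ≤ (Polynomial.Chebyshev.S ℝ n).eval (2 * Real.cos (Real.pi / m)) := by
  have hn' : (0 : ℝ) ≤ n + 1 := by exact_mod_cast (by omega : 0 ≤ n + 1)
  rcases eq_or_ne m 0 with rfl | h0
  · simpa [Polynomial.Chebyshev.S_eval_two] using hn'
  · have hm2 : (2 : ℝ) ≤ m := by exact_mod_cast (by omega : 2 ≤ m)
    have hnm' : ((n : ℝ) + 1) ≤ m := by
      have := hnm h0
      exact_mod_cast (by omega : n + 1 ≤ m)
    have hπ := Real.pi_pos
    have hmθ : (m : ℝ) * (Real.pi / m) = Real.pi := by field_simp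
    have hθ : 0 < Real.pi / m := by positivity
    have hs : 0 < Real.sin (Real.pi / m) :=
      Real.sin_pos_of_pos_of_lt_pi hθ (by nlinarith)
    have hs' : 0 ≤ Real.sin ((n + 1) * (Real.pi / m)) :=
      Real.sin_nonneg_of_nonneg_of_le_pi (by positivity) (by nlinarith)
    rw [← Polynomial.Chebyshev.S_two_mul_real_cos] at hs'
    exact nonneg_of_mul_nonneg_left hs' hs

/-- Every element factors, with additive length, as the product of an element without a right
descent in `{i, j}` and an alternating word in `i` and `j`. -/
lemma exists_eq_mul_alternatingWord (i j : B) (w : W) :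
    ∃ (v : W) (k : ℕ), (w = v * cs.wordProd (alternatingWord i j k) ∨
      w = v * cs.wordProd (alternatingWord j i k)) ∧ cs.length w = cs.length v + k ∧
      ¬ cs.IsRightDescent v i ∧ ¬ cs.IsRightDescent v j := by
  -- Strip a right descent `p` of `w`; the resulting alternating word cannot itself end with `p`,
  -- as otherwise `w` would be too short.
  have key (p q : B) (w v : W) (k : ℕ) (hp : cs.length (w * cs.simple p) + 1 = cs.length w)
      (hlen : cs.length (w * cs.simple p) = cs.length v + k)
      (h : w * cs.simple p = v * cs.wordProd (alternatingWord p q k) ∨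
        w * cs.simple p = v * cs.wordProd (alternatingWord q p k)) :
      w = v * cs.wordProd (alternatingWord q p (k + 1)) := by
    have hw : w = w * cs.simple p * cs.simple p := by simp
    rcases h with h | h
    · rw [hw, h, alternatingWord_succ, wordProd_concat, mul_assoc]
    · cases k with
      | zero =>
        rw [hw, h, alternatingWord_succ, wordProd_concat, mul_assoc]
        simp [alternatingWord]
      | succ k =>
        rw [alternatingWord_succ, wordProd_concat, ← mul_assoc] at h
        have hw' : w = v * cs.wordProd (alternatingWord p q k) := by simpa using h
        have h1 := cs.length_mul_le v (cs.wordProd (alternatingWord p q k))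
        have h2 := cs.length_wordProd_le (alternatingWord p q k)
        rw [← hw'] at h1
        rw [length_alternatingWord] at h2
        omega
  induction hn : cs.length w using Nat.strong_induction_on generalizing w with
  | _ n ih =>
    subst hn
    by_cases hi : cs.IsRightDescent w i
    · have hi' := cs.isRightDescent_iff.1 hi
      obtain ⟨v, k, h, hlen, hvi, hvj⟩ := ih _ hi _ rfl
      exact ⟨v, k + 1, Or.inr (key i j w v k hi' hlen h), by omega, hvi, hvj⟩
    by_cases hj : cs.IsRightDescent w j
    · have hj' := cs.isRightDescent_iff.1 hj
      obtain ⟨v, k, h, hlen, hvi, hvj⟩ := ih _ hj _ rfl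
      exact ⟨v, k + 1, Or.inl (key j i w v k hj' hlen h.symm), by omega, hvi, hvj⟩
    exact ⟨w, 0, by simp [alternatingWord], by simp, hi, hj⟩

/-- If `ℓ (w s_i) > ℓ w`, then `w e_i` is a positive root. -/
theorem geomRep_single_nonneg (w : W) (i : B) (hi : ¬ cs.IsRightDescent w i) :
    0 ≤ cs.geomRep w (Finsupp.single i 1) := by
  induction hn : cs.length w using Nat.strong_induction_on generalizing w i with
  | _ n ih =>
    subst hn
    rcases eq_or_ne w 1 with rfl | hw
    · rw [geomRep_one_apply]
      exact Finsupp.single_nonneg.2 zero_le_one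
    obtain ⟨j, hj⟩ := cs.exists_rightDescent_of_ne_one hw
    have hij : i ≠ j := by rintro rfl; exact hi hj
    obtain ⟨v, k, h, hlen, hvi, hvj⟩ := cs.exists_eq_mul_alternatingWord i j w
    have hk : k ≠ 0 := by
      rintro rfl
      obtain rfl : w = v := by simpa [alternatingWord] using h
      exact hvj hj
    -- `w` has no factorization whose alternating part ends with `i`.
    have hend : ¬ w = v * cs.wordProd (alternatingWord j i k) := by
      intro hw'
      obtain ⟨k, rfl⟩ := Nat.exists_eq_succ_of_ne_zero hk
      rw [Nat.succ_eq_add_one, alternatingWord_succ, wordProd_concat, ← mul_assoc] at hw'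
      have h0 : w * cs.simple i = v * cs.wordProd (alternatingWord i j k) := by
        rw [hw']; simp
      have h1 := cs.length_mul_le v (cs.wordProd (alternatingWord i j k))
      have h2 := cs.length_wordProd_le (alternatingWord i j k)
      rw [← h0] at h1
      rw [length_alternatingWord] at h2
      exact hi (by unfold IsRightDescent; omega)
    have hw' := h.resolve_right hend
    have hkm : M i j ≠ 0 → k < M i j := by
      intro h0
      by_contra hge
      rcases (not_lt.1 hge).eq_or_lt with heq | hlt
      · apply hend
        rw [hw', ← heq]
        congr 1
        have := cs.wordProd_braidWord_eq i j
        rwa [braidWord, braidWord, M.symmetric j i] at this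
      · have h1 := cs.length_mul_le v (cs.wordProd (alternatingWord i j k))
        have h2 := cs.length_wordProd_le (alternatingWord i j k)
        have h3 := cs.not_isReduced_alternatingWord i j h0 hlt
        rw [← hw'] at h1
        rw [IsReduced] at h3
        rw [length_alternatingWord] at h2 h3
        omega
    have hvi' := ih _ (by omega) v i hvi rfl
    have hvj' := ih _ (by omega) v j hvj rfl
    have hm1 : M i j ≠ 1 := M.off_diagonal i j hij
    have hc1 := eval_chebyshevS_nonneg hm1 (n := k) (by omega)
      (fun h0 => by exact_mod_cast hkm h0)
    have hc2 := eval_chebyshevS_nonneg hm1 (n := (k : ℤ) - 1) (by omega)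
      (fun h0 => by have := hkm h0; omega)
    rw [hw', geomRep_mul_apply, geomRep_alternatingWord_single, map_add, map_smul, map_smul]
    refine add_nonneg (smul_nonneg hc1 ?_) (smul_nonneg hc2 ?_)
    · split_ifs <;> assumption
    · split_ifs <;> assumption

/-- If `ℓ (w s_i) < ℓ w`, then `w e_i` is a negative root. -/
theorem geomRep_single_nonpos (w : W) (i : B) (hi : cs.IsRightDescent w i) :
    cs.geomRep w (Finsupp.single i 1) ≤ 0 := by
  have h := cs.geomRep_single_nonneg (w * cs.simple i) i
    (cs.isRightDescent_iff_not_isRightDescent_mul.1 hi)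
  rwa [geomRep_mul_apply, geomRep_simple_single_self, map_neg, Left.nonneg_neg_iff] at h

lemma geomRep_single_ne_zero (w : W) (i : B) : cs.geomRep w (Finsupp.single i 1) ≠ 0 := by
  simp

/-- An element that makes no basis vector negative is trivial. -/
lemma eq_one_of_geomRep_single_nonneg (w : W)
    (h : ∀ i, 0 ≤ cs.geomRep w (Finsupp.single i 1)) : w = 1 := by
  by_contra hw
  obtain ⟨i, hi⟩ := cs.exists_rightDescent_of_ne_one hw
  exact cs.geomRep_single_ne_zero w i (le_antisymm (cs.geomRep_single_nonpos w i hi) (h i))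

/-- A root of the geometric representation: a vector in the orbit of a basis vector. -/
def IsRoot (v : B →₀ ℝ) : Prop := ∃ (w : W) (i : B), v = cs.geomRep w (Finsupp.single i 1)

/-- A positive root: a root with nonnegative coordinates. -/
def IsPosRoot (v : B →₀ ℝ) : Prop := cs.IsRoot v ∧ 0 ≤ v

variable {cs}

lemma IsRoot.geomRep {v : B →₀ ℝ} (hv : cs.IsRoot v) (w : W) : cs.IsRoot (cs.geomRep w v) := by
  obtain ⟨u, i, rfl⟩ := hv
  exact ⟨w * u, i, by rw [geomRep_mul_apply]⟩

lemma IsRoot.neg {v : B →₀ ℝ} (hv : cs.IsRoot v) : cs.IsRoot (-v) := by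
  obtain ⟨w, i, rfl⟩ := hv
  exact ⟨w * cs.simple i, i, by rw [geomRep_mul_apply, geomRep_simple_single_self, map_neg]⟩

lemma IsRoot.ne_zero {v : B →₀ ℝ} (hv : cs.IsRoot v) : v ≠ 0 := by
  obtain ⟨w, i, rfl⟩ := hv
  exact cs.geomRep_single_ne_zero w i

lemma IsRoot.nonneg_or_nonpos {v : B →₀ ℝ} (hv : cs.IsRoot v) : 0 ≤ v ∨ v ≤ 0 := by
  obtain ⟨w, i, rfl⟩ := hv
  by_cases hi : cs.IsRightDescent w i
  · exact Or.inr (cs.geomRep_single_nonpos w i hi)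
  · exact Or.inl (cs.geomRep_single_nonneg w i hi)

lemma IsRoot.canonicalForm_self {v : B →₀ ℝ} (hv : cs.IsRoot v) : M.canonicalForm v v = 2 := by
  obtain ⟨w, i, rfl⟩ := hv
  rw [canonicalForm_geomRep, M.canonicalForm_single, M.simpleCoroot_single_self]

variable (cs) in
lemma isPosRoot_single (i : B) : cs.IsPosRoot (Finsupp.single i 1) :=
  ⟨⟨1, i, by rw [geomRep_one_apply]⟩, Finsupp.single_nonneg.2 zero_le_one⟩

/-- The simple reflection `s_i` permutes the positive roots other than `e_i`. -/
lemma IsPosRoot.geomRep_simple {v : B →₀ ℝ} (hv : cs.IsPosRoot v) {i : B}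
    (hne : v ≠ Finsupp.single i 1) : cs.IsPosRoot (cs.geomRep (cs.simple i) v) := by
  refine ⟨hv.1.geomRep _, (hv.1.geomRep _).nonneg_or_nonpos.resolve_right fun hneg => hne ?_⟩
  -- Only the `i`-th coordinate changes, so `v` is a multiple of `e_i`; it has the norm of `e_i`.
  have hcoord : ∀ j, j ≠ i → v j = 0 := by
    intro j hj
    refine le_antisymm ?_ (hv.2 j)
    have := hneg j
    simpa [geomRep_simple_apply, Finsupp.single_apply, hj.symm] using this
  have hvi : v = v i • Finsupp.single i (1 : ℝ) := by
    ext j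
    rcases eq_or_ne j i with rfl | hj
    · simp
    · simp [hcoord j hj, hj.symm]
  have hsq := hv.1.canonicalForm_self
  rw [hvi] at hsq
  simp only [map_smul, LinearMap.smul_apply, M.canonicalForm_single, M.simpleCoroot_single_self,
    smul_eq_mul] at hsq
  have h0 : 0 ≤ v i := hv.2 i
  have h1 : v i = 1 := by nlinarith
  rw [hvi, h1, one_smul]

/-! ### Inversion sets -/

variable (cs)

/-- The positive roots made negative by `w`. -/
def invSet (w : W) : Set (B →₀ ℝ) := {v | cs.IsPosRoot v ∧ cs.geomRep w v ≤ 0}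

lemma finite_invSet (w : W) : (cs.invSet w).Finite := by
  induction w using cs.simple_induction_right with
  | one =>
    refine Set.finite_empty.subset fun v ⟨hv, h⟩ => hv.1.ne_zero (le_antisymm ?_ hv.2)
    rwa [geomRep_one_apply] at h
  | mul_simple_right w i ih =>
    refine ((ih.image (cs.geomRep (cs.simple i))).insert (Finsupp.single i 1)).subset ?_
    intro v hv
    by_cases hne : v = Finsupp.single i 1
    · exact Or.inl hne
    · refine Or.inr ⟨cs.geomRep (cs.simple i) v, ⟨hv.1.geomRep_simple hne, ?_⟩, ?_⟩
      · rw [← geomRep_mul_apply]; exact hv.2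
      · rw [← geomRep_mul_apply, simple_mul_simple_self, geomRep_one_apply]

lemma invSet_injective : Function.Injective cs.invSet := by
  intro g h hgh
  rw [← mul_inv_eq_one]
  refine cs.eq_one_of_geomRep_single_nonneg _ fun i => ?_
  have hi := cs.isPosRoot_single i
  rw [geomRep_mul_apply]
  set v := cs.geomRep h⁻¹ (Finsupp.single i 1)
  have hhv : cs.geomRep h v = Finsupp.single i 1 := cs.geomRep_apply_inv_self _ _
  have hroot : cs.IsRoot v := hi.1.geomRep _
  rcases hroot.nonneg_or_nonpos with hpos | hneg
  · refine ((hroot.geomRep g).nonneg_or_nonpos).resolve_right fun hg => ?_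
    have hmem : v ∈ cs.invSet g := ⟨⟨hroot, hpos⟩, hg⟩
    rw [hgh] at hmem
    have := hmem.2
    rw [hhv] at this
    exact hi.1.ne_zero (le_antisymm this hi.2)
  · have hmem : -v ∈ cs.invSet h := by
      refine ⟨⟨hroot.neg, Left.nonneg_neg_iff.2 hneg⟩, ?_⟩
      rw [map_neg, hhv]
      exact Left.neg_nonpos_iff.2 hi.2
    rw [← hgh] at hmem
    have := hmem.2
    rwa [map_neg, Left.neg_nonpos_iff] at this

end CoxeterSystem

/-! ### Stabilizers of points of the Tits cone -/

namespace CoxeterSystem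

variable {B W : Type*} [Group W] {M : CoxeterMatrix B} (cs : CoxeterSystem M W)

/-- The stabilizer in `W` of a linear functional on the geometric representation. -/
def functionalStabilizer (x : Module.Dual ℝ (B →₀ ℝ)) : Subgroup W where
  carrier := {w | ∀ v, x (cs.geomRep w v) = x v}
  one_mem' v := by rw [geomRep_one_apply]
  mul_mem' {g h} hg hh v := by rw [geomRep_mul_apply, hg, hh]
  inv_mem' {g} hg v := by rw [← hg, geomRep_apply_inv_self]

variable {cs} in
lemma mem_functionalStabilizer {x : Module.Dual ℝ (B →₀ ℝ)} {w : W} :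
    w ∈ cs.functionalStabilizer x ↔ ∀ v, x (cs.geomRep w v) = x v := Iff.rfl

/-- The Tits cone, as the set of linear functionals that are negative on only finitely many positive
roots. This description makes convexity evident, and agrees with the union of the `W`-translates of
the dominant functionals by `InTitsCone.exists_geomRep_single_nonneg` and `finite_invSet`. -/
def InTitsCone (x : Module.Dual ℝ (B →₀ ℝ)) : Prop := {v | cs.IsPosRoot v ∧ x v < 0}.Finite

variable {cs}

/-- Every point of the Tits cone has a dominant translate. -/
lemma InTitsCone.exists_geomRep_single_nonneg {x : Module.Dual ℝ (B →₀ ℝ)}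
    (hx : cs.InTitsCone x) : ∃ w : W, ∀ i, 0 ≤ x (cs.geomRep w (Finsupp.single i 1)) := by
  induction hn : {v | cs.IsPosRoot v ∧ x v < 0}.ncard using Nat.strong_induction_on
    generalizing x with
  | _ n ih =>
    subst hn
    by_cases h : ∀ i, 0 ≤ x (Finsupp.single i 1)
    · exact ⟨1, fun i => by rw [geomRep_one_apply]; exact h i⟩
    push Not at h
    obtain ⟨i, hi⟩ := h
    -- Reflecting in `e_i` removes `e_i` from the positive roots on which `x` is negative.
    set N : Set (B →₀ ℝ) := {v | cs.IsPosRoot v ∧ x v < 0}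
    set x' : Module.Dual ℝ (B →₀ ℝ) := x ∘ₗ (cs.geomRep (cs.simple i)).toLinearMap
    have hx'v : ∀ v, x' v = x (cs.geomRep (cs.simple i) v) := fun _ => rfl
    have hmem : Finsupp.single i 1 ∈ N := ⟨cs.isPosRoot_single i, hi⟩
    have hsub : {v | cs.IsPosRoot v ∧ x' v < 0} ⊆
        cs.geomRep (cs.simple i) '' (N \ {Finsupp.single i 1}) := by
      rintro v ⟨hv, hv'⟩
      rw [hx'v] at hv'
      have hinv : cs.geomRep (cs.simple i) (cs.geomRep (cs.simple i) v) = v := by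
        rw [← geomRep_mul_apply, simple_mul_simple_self, geomRep_one_apply]
      have hne : v ≠ Finsupp.single i 1 := by
        rintro rfl
        rw [geomRep_simple_single_self, map_neg] at hv'
        linarith
      refine ⟨_, ⟨⟨hv.geomRep_simple hne, hv'⟩, fun heq => ?_⟩, hinv⟩
      rw [Set.mem_singleton_iff] at heq
      rw [heq, geomRep_simple_single_self] at hinv
      rw [← hinv] at hv
      exact (cs.isPosRoot_single i).1.ne_zero
        (le_antisymm (Left.nonneg_neg_iff.1 hv.2) (cs.isPosRoot_single i).2)
    have hfin : (N \ {Finsupp.single i 1}).Finite := hx.subset Set.sdiff_subset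
    have hlt : {v | cs.IsPosRoot v ∧ x' v < 0}.ncard < N.ncard :=
      (Set.ncard_le_ncard hsub (hfin.image _)).trans_lt <|
        (Set.ncard_image_le hfin).trans_lt (Set.ncard_sdiff_singleton_lt_of_mem hmem hx)
    obtain ⟨w, hw⟩ := ih _ hlt ((hfin.image _).subset hsub) rfl
    exact ⟨cs.simple i * w, fun j => by rw [geomRep_mul_apply]; exact hw j⟩

lemma apply_nonneg_of_dominant {c : Module.Dual ℝ (B →₀ ℝ)}
    (hc : ∀ i, 0 ≤ c (Finsupp.single i 1)) {v : B →₀ ℝ} (hv : 0 ≤ v) : 0 ≤ c v := by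
  have hsum : c v = v.sum fun i a => a * c (Finsupp.single i 1) := by
    conv_lhs => rw [← Finsupp.sum_single v]
    rw [map_finsuppSum]
    refine Finsupp.sum_congr fun i _ => ?_
    rw [← smul_eq_mul, ← map_smul, Finsupp.smul_single_one]
  rw [hsum]
  exact Finset.sum_nonneg fun i _ => mul_nonneg (hv i) (hc i)

variable (cs)

/-- The stabilizer of a dominant functional `c` is generated by the simple reflections in it. -/
lemma functionalStabilizer_of_dominant {c : Module.Dual ℝ (B →₀ ℝ)}
    (hc : ∀ i, 0 ≤ c (Finsupp.single i 1)) :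
    cs.functionalStabilizer c = cs.visibleSubgroup {i | c (Finsupp.single i 1) = 0} := by
  have hsimple : ∀ i, c (Finsupp.single i 1) = 0 → cs.simple i ∈ cs.functionalStabilizer c := by
    intro i hi v
    rw [geomRep_simple_apply, map_sub, map_smul, hi, smul_zero, sub_zero]
  apply le_antisymm
  · intro w hw
    induction hn : cs.length w using Nat.strong_induction_on generalizing w with
    | _ n ih =>
      subst hn
      rcases eq_or_ne w 1 with rfl | hw1
      · exact one_mem _
      obtain ⟨i, hi⟩ := cs.exists_rightDescent_of_ne_one hw1
      have hi0 : c (Finsupp.single i 1) = 0 := by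
        refine le_antisymm ?_ (hc i)
        have hneg : 0 ≤ -cs.geomRep w (Finsupp.single i 1) :=
          Left.nonneg_neg_iff.2 (cs.geomRep_single_nonpos w i hi)
        have := apply_nonneg_of_dominant hc hneg
        rw [map_neg, hw] at this
        linarith
      have hmem := ih _ hi (mul_mem hw (hsimple i hi0)) rfl
      have hs : cs.simple i ∈ cs.visibleSubgroup {i | c (Finsupp.single i 1) = 0} :=
        Subgroup.subset_closure ⟨i, hi0, rfl⟩
      simpa using mul_mem hmem hs
  · refine (Subgroup.closure_le _).2 ?_
    rintro _ ⟨i, hi, rfl⟩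
    exact hsimple i hi

lemma map_conj_functionalStabilizer_comp (x : Module.Dual ℝ (B →₀ ℝ)) (w : W) :
    (cs.functionalStabilizer (x ∘ₗ (cs.geomRep w).toLinearMap)).map (MulAut.conj w).toMonoidHom =
      cs.functionalStabilizer x := by
  ext g
  rw [Subgroup.mem_map_equiv]
  simp only [mem_functionalStabilizer, LinearMap.comp_apply, LinearEquiv.coe_coe,
    MulAut.conj_symm_apply, ← geomRep_mul_apply]
  constructor
  · intro h v
    have := h (cs.geomRep w⁻¹ v)
    simpa only [← geomRep_mul_apply, mul_assoc, mul_inv_cancel, mul_one, mul_inv_cancel_left,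
      geomRep_one_apply] using this
  · intro h v
    have := h (cs.geomRep w v)
    simpa only [← geomRep_mul_apply, mul_assoc, mul_inv_cancel_left] using this

variable {cs}

/-- The stabilizer of a point of the Tits cone is parabolic. -/
lemma InTitsCone.isParabolic {x : Module.Dual ℝ (B →₀ ℝ)} (hx : cs.InTitsCone x) :
    cs.IsParabolic (cs.functionalStabilizer x) := by
  obtain ⟨w, hw⟩ := hx.exists_geomRep_single_nonneg
  refine ⟨w, {i | x (cs.geomRep w (Finsupp.single i 1)) = 0}, ?_⟩
  rw [← cs.map_conj_functionalStabilizer_comp x w]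
  exact congrArg _ (cs.functionalStabilizer_of_dominant
    (c := x ∘ₗ (cs.geomRep w).toLinearMap) hw)

/-- The stabilizer of a point of the Tits cone on which only finitely many roots vanish is
finite: the inversions of its elements lie among these roots. -/
lemma InTitsCone.finite_functionalStabilizer {x : Module.Dual ℝ (B →₀ ℝ)} (hx : cs.InTitsCone x)
    (h0 : {v | cs.IsRoot v ∧ x v = 0}.Finite) : Finite (cs.functionalStabilizer x) := by
  obtain ⟨w, hw⟩ := hx.exists_geomRep_single_nonneg
  set c : Module.Dual ℝ (B →₀ ℝ) := x ∘ₗ (cs.geomRep w).toLinearMap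
  have hcdom : ∀ i, 0 ≤ c (Finsupp.single i 1) := hw
  have hZ : {v | cs.IsRoot v ∧ c v = 0}.Finite :=
    (h0.preimage (cs.geomRep w).injective.injOn).subset fun v hv => ⟨hv.1.geomRep w, hv.2⟩
  have hc : (cs.functionalStabilizer c : Set W).Finite := by
    refine (hZ.finite_subsets.preimage cs.invSet_injective.injOn).subset fun g hg v hv => ?_
    refine ⟨hv.1.1, le_antisymm ?_ (apply_nonneg_of_dominant hcdom hv.1.2)⟩
    have := apply_nonneg_of_dominant hcdom (Left.nonneg_neg_iff.2 hv.2)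
    rw [map_neg] at this
    have hgv : c (cs.geomRep g v) = c v := hg v
    change 0 ≤ -(c (cs.geomRep g v)) at this
    change c v ≤ 0
    linarith
  rw [← cs.map_conj_functionalStabilizer_comp x w]
  exact (hc.image _).to_subtype

variable (cs) in
/-- A finite subgroup `F` fixes the sum of the `F`-orbit of a strictly dominant functional. This sum
is a point of the Tits cone with finite stabilizer. -/
lemma exists_inTitsCone_of_finite (F : Subgroup W) [Finite F] :
    ∃ x, cs.InTitsCone x ∧ Finite (cs.functionalStabilizer x) ∧
      F ≤ cs.functionalStabilizer x := by
  have := Fintype.ofFinite F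
  set ρ : Module.Dual ℝ (B →₀ ℝ) := Finsupp.linearCombination ℝ fun _ => 1 with hρ
  have hρpos : ∀ v : B →₀ ℝ, 0 ≤ v → v ≠ 0 → 0 < ρ v := by
    intro v hv hv0
    rw [hρ, Finsupp.linearCombination_apply]
    obtain ⟨i, hi⟩ := Finsupp.support_nonempty_iff.2 hv0
    refine Finset.sum_pos' (fun j _ => by simpa using hv j) ⟨i, hi, ?_⟩
    simpa using lt_of_le_of_ne (hv i) (Ne.symm (Finsupp.mem_support_iff.1 hi))
  set x : Module.Dual ℝ (B →₀ ℝ) :=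
    ∑ f : F, ρ ∘ₗ (cs.geomRep (f : W)).toLinearMap with hx
  have hxv : ∀ v, x v = ∑ f : F, ρ (cs.geomRep (f : W) v) := by
    intro v
    rw [hx, LinearMap.sum_apply]
    rfl
  have hinv : ∀ v, cs.IsPosRoot v → x v ≤ 0 → v ∈ ⋃ f : F, cs.invSet (f : W) := by
    intro v hv hxv0
    by_contra hnot
    have hF : ∀ f : F, 0 < ρ (cs.geomRep (f : W) v) := fun f =>
      hρpos _ ((hv.1.geomRep _).nonneg_or_nonpos.resolve_right fun hle =>
        hnot (Set.mem_iUnion.2 ⟨f, hv, hle⟩)) (hv.1.geomRep _).ne_zero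
    rw [hxv] at hxv0
    exact absurd hxv0 (not_le.2 (Finset.sum_pos (fun f _ => hF f) ⟨1, Finset.mem_univ _⟩))
  have hfin : (⋃ f : F, cs.invSet (f : W)).Finite :=
    Set.finite_iUnion fun f => cs.finite_invSet _
  have hcone : cs.InTitsCone x := hfin.subset fun v hv => hinv v hv.1 hv.2.le
  refine ⟨x, hcone, hcone.finite_functionalStabilizer ?_, fun g hg v => ?_⟩
  · refine (hfin.union (hfin.preimage neg_injective.injOn)).subset fun v hv => ?_
    rcases hv.1.nonneg_or_nonpos with h | h
    · exact Or.inl (hinv v ⟨hv.1, h⟩ hv.2.le)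
    · refine Or.inr (hinv (-v) ⟨hv.1.neg, Left.nonneg_neg_iff.2 h⟩ ?_)
      rw [map_neg, hv.2, neg_zero]
  · rw [hxv, hxv]
    exact Fintype.sum_equiv (Equiv.mulRight (⟨g, hg⟩ : F)) _ _
      fun f => by simp

protected lemma countable [Finite B] (cs : CoxeterSystem M W) : Countable W :=
  cs.wordProd_surjective.countable

/-- The stabilizers of points of the Tits cone are closed under intersection: all but countably
many points of the segment from `x` to `y` are fixed only by elements fixing both `x` and `y`. -/
lemma InTitsCone.exists_inf_eq [Countable W] {x y : Module.Dual ℝ (B →₀ ℝ)}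
    (hx : cs.InTitsCone x) (hy : cs.InTitsCone y) :
    ∃ z, cs.InTitsCone z ∧
      cs.functionalStabilizer z = cs.functionalStabilizer x ⊓ cs.functionalStabilizer y := by
  set p : ℝ → Module.Dual ℝ (B →₀ ℝ) := fun t => (1 - t) • x + t • y with hp
  have hpv : ∀ t v, p t v = (1 - t) * x v + t * y v := fun t v => by simp [hp]
  set bad : W → Set ℝ := fun w => {t | w ∉ cs.functionalStabilizer x ⊓ cs.functionalStabilizer y ∧
    w ∈ cs.functionalStabilizer (p t)}
  have hsub : ∀ w, (bad w).Subsingleton := by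
    rintro w s ⟨hw, hs⟩ t ⟨-, ht⟩
    by_contra hst
    refine hw ?_
    have hst' : s - t ≠ 0 := sub_ne_zero.2 hst
    have hdiff : ∀ v, y (cs.geomRep w v) - x (cs.geomRep w v) = y v - x v := by
      intro v
      have h1 := hs v
      have h2 := ht v
      rw [hpv, hpv] at h1 h2
      apply mul_left_cancel₀ hst'
      linear_combination h1 - h2
    have hxw : ∀ v, x (cs.geomRep w v) = x v := by
      intro v
      have h1 := hs v
      rw [hpv, hpv] at h1
      linear_combination h1 - s * hdiff v
    exact ⟨hxw, fun v => by linear_combination hdiff v + hxw v⟩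
  have hcount : (⋃ w, bad w).Countable := Set.countable_iUnion fun w => (hsub w).countable
  obtain ⟨t, ⟨ht0, ht1⟩, ht⟩ : (Set.Ioo (0 : ℝ) 1 \ ⋃ w, bad w).Nonempty := by
    by_contra hne
    rw [Set.not_nonempty_iff_eq_empty, Set.sdiff_eq_empty] at hne
    exact (Cardinal.Real.Ioo_countable_iff.1 (hcount.mono hne)).not_gt zero_lt_one
  refine ⟨p t, ?_, le_antisymm (fun w hw => ?_) fun w hw v => ?_⟩
  · refine (Set.Finite.union hx hy).subset fun v hv => ?_
    by_contra hnot
    have hxv : 0 ≤ x v := not_lt.1 fun h => hnot (Or.inl ⟨hv.1, h⟩)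
    have hyv : 0 ≤ y v := not_lt.1 fun h => hnot (Or.inr ⟨hv.1, h⟩)
    have := hv.2
    rw [hpv] at this
    nlinarith
  · by_contra hnot
    exact ht (Set.mem_iUnion.2 ⟨w, hnot, hw⟩)
  · rw [hpv, hpv, hw.1 v, hw.2 v]

end CoxeterSystem

/-! ### Maximal finite subgroups and finite continuations -/

namespace CoxeterSystem

variable {B W : Type*} [Group W] {M : CoxeterMatrix B}

/-- The finite subgroups have bounded order: each lies in a finite conjugate of one of the finitely
many visible subgroups. -/
lemma exists_card_le_of_finite_subgroup [Finite B] (cs : CoxeterSystem M W) :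
    ∃ N : ℕ, ∀ F : Subgroup W, Finite F → Nat.card F ≤ N := by
  obtain ⟨N, hN⟩ := (Set.finite_range fun I : Set B => Nat.card (cs.visibleSubgroup I)).bddAbove
  refine ⟨N, fun F hF => ?_⟩
  obtain ⟨x, hx, hfin, hle⟩ := cs.exists_inTitsCone_of_finite F
  obtain ⟨w, I, hI⟩ := hx.isParabolic
  refine (Nat.card_le_card_of_injective _ (Subgroup.inclusion_injective hle)).trans ?_
  rw [hI, Subgroup.card_map_of_injective (MulAut.conj w).injective]
  exact hN ⟨I, rfl⟩

lemma exists_isMaximalFiniteSubgroup_ge [Finite B] (cs : CoxeterSystem M W)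
    (F : Subgroup W) [hF : Finite F] :
    ∃ K, IsMaximalFiniteSubgroup K ∧ F ≤ K := by
  obtain ⟨N, hN⟩ := cs.exists_card_le_of_finite_subgroup
  set S : Set ℕ := {n | ∃ K : Subgroup W, Finite K ∧ F ≤ K ∧ Nat.card K = n}
  have hbdd : BddAbove S := ⟨N, by rintro _ ⟨K, hK, -, rfl⟩; exact hN K hK⟩
  obtain ⟨K, hK, hFK, hcard⟩ := Nat.sSup_mem (s := S) ⟨_, F, hF, le_rfl, rfl⟩ hbdd
  refine ⟨K, ⟨hK, fun L (hL : Finite L) hKL => ?_⟩, hFK⟩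
  have hle : Nat.card L ≤ Nat.card K := hcard ▸ le_csSup hbdd ⟨L, hL, hFK.trans hKL, rfl⟩
  exact (Subgroup.eq_of_le_of_card_ge hKL hle).ge

/-- The finite continuation of an element of finite order is a finite parabolic subgroup. It is
the stabilizer of a point of the Tits cone: a minimal finite stabilizer containing it lies in
every maximal finite subgroup containing the element. -/
theorem isParabolic_finiteContinuation [Finite B] (cs : CoxeterSystem M W) {g : W}
    (hg : IsOfFinOrder g) :
    cs.IsParabolic (finiteContinuation g) ∧ Finite (finiteContinuation g) := by
  have := cs.countable
  have hmax : ∀ H : Subgroup W, IsMaximalFiniteSubgroup H →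
      ∃ x, cs.InTitsCone x ∧ H = cs.functionalStabilizer x := by
    intro H hH
    have : Finite H := hH.prop
    obtain ⟨x, hx, hfin, hle⟩ := cs.exists_inTitsCone_of_finite H
    exact ⟨x, hx, hH.eq_of_le hfin hle⟩
  have : Finite (Subgroup.zpowers g) := hg.finite_zpowers
  obtain ⟨H₀, hH₀, hgH₀⟩ := cs.exists_isMaximalFiniteSubgroup_ge (Subgroup.zpowers g)
  set S : Set ℕ := {n | ∃ x, cs.InTitsCone x ∧ Finite (cs.functionalStabilizer x) ∧
    finiteContinuation g ≤ cs.functionalStabilizer x ∧ Nat.card (cs.functionalStabilizer x) = n}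
  have hS : S.Nonempty := by
    obtain ⟨x, hx, rfl⟩ := hmax H₀ hH₀
    exact ⟨_, x, hx, hH₀.prop, sInf_le ⟨hH₀, hgH₀ (Subgroup.mem_zpowers g)⟩, rfl⟩
  obtain ⟨x, hx, hfin, hle, hcard⟩ := Nat.sInf_mem hS
  have heq : finiteContinuation g = cs.functionalStabilizer x := by
    refine le_antisymm hle (le_sInf fun H hH => ?_)
    obtain ⟨y, hy, rfl⟩ := hmax H hH.1
    obtain ⟨z, hz, hzeq⟩ := hx.exists_inf_eq hy
    have hzx : cs.functionalStabilizer z ≤ cs.functionalStabilizer x := hzeq ▸ inf_le_left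
    have hzfin : Finite (cs.functionalStabilizer z) :=
      Finite.of_injective _ (Subgroup.inclusion_injective hzx)
    have hz' : Nat.card (cs.functionalStabilizer x) ≤ Nat.card (cs.functionalStabilizer z) := by
      rw [hcard]
      exact Nat.sInf_le ⟨z, hz, hzfin, hzeq ▸ le_inf hle (sInf_le hH), rfl⟩
    rw [← Subgroup.eq_of_le_of_card_ge hzx hz', hzeq]
    exact inf_le_right
  rw [heq]
  exact ⟨hx.isParabolic, hfin⟩

end CoxeterSystem

lemma IsMaximalFiniteSubgroup.comap {G G' : Type*} [Group G] [Group G'] (e : G ≃* G')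
    {H : Subgroup G'} (hH : IsMaximalFiniteSubgroup H) :
    IsMaximalFiniteSubgroup (H.comap e.toMonoidHom) := by
  have hfin : Finite H := hH.prop
  refine ⟨?_, fun K (hK : Finite K) hle => ?_⟩
  · exact ((H : Set G').toFinite.preimage e.injective.injOn).to_subtype
  · have hK' : Finite (K.map e.toMonoidHom) := ((K : Set G).toFinite.image e).to_subtype
    refine Subgroup.map_le_iff_le_comap.1 (hH.le_of_ge hK' fun h hh => ?_)
    exact ⟨e.symm h, hle (by simpa using hh), by simp⟩

lemma map_mem_finiteContinuation {G G' : Type*} [Group G] [Group G'] (e : G ≃* G')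
    {g x : G} (hx : x ∈ finiteContinuation g) : e x ∈ finiteContinuation (e g) := by
  refine Subgroup.mem_sInf.2 fun H hH => ?_
  exact Subgroup.mem_sInf.1 hx _ ⟨hH.1.comap e, hH.2⟩

lemma mem_finiteContinuation_self {G : Type*} [Group G] (g : G) : g ∈ finiteContinuation g :=
  Subgroup.mem_sInf.2 fun _ hH => hH.2

theorem proposition3p9 {B B' : Type*} [Finite B] [Finite B']
    {W W' : Type*} [Group W] [Group W']
    {M : CoxeterMatrix B} {M' : CoxeterMatrix B'}
    (cs : CoxeterSystem M W) (cs' : CoxeterSystem M' W')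
    (α : W ≃* W') (a : B) (ha : ¬ cs'.IsReflection (α (cs.simple a))) :
    cs.IsParabolic (finiteContinuation (cs.simple a)) ∧
      2 < Nat.card (finiteContinuation (cs.simple a)) := by
  have hord : IsOfFinOrder (cs.simple a) :=
    isOfFinOrder_iff_pow_eq_one.2 ⟨2, two_pos, cs.simple_sq a⟩
  obtain ⟨hpar, hfin⟩ := cs.isParabolic_finiteContinuation hord
  refine ⟨hpar, ?_⟩
  have hne : cs.simple a ≠ 1 := fun h => by simpa [h] using cs.length_simple a
  have hord' : IsOfFinOrder (α (cs.simple a)) := MonoidHom.isOfFinOrder α.toMonoidHom hord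
  obtain ⟨⟨w, J, hJ⟩, -⟩ := cs'.isParabolic_finiteContinuation hord'
  have hJne : J.Nonempty := by
    by_contra hemp
    rw [Set.not_nonempty_iff_eq_empty] at hemp
    have hmem := mem_finiteContinuation_self (α (cs.simple a))
    rw [hJ, hemp, CoxeterSystem.visibleSubgroup, Set.image_empty, Subgroup.closure_empty,
      Subgroup.map_bot, Subgroup.mem_bot] at hmem
    exact hne (by simpa using hmem)
  obtain ⟨j, hj⟩ := hJne
  -- The finite continuation of `α r_a` contains a reflection `t`, which is neither `1` nor `α r_a`.
  set t := w * cs'.simple j * w⁻¹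
  have htref : cs'.IsReflection t := ⟨w, j, rfl⟩
  have ht1 : t ≠ 1 := fun h => by
    have := htref.odd_length
    simp [h] at this
  have htmem : t ∈ finiteContinuation (α (cs.simple a)) := by
    rw [hJ]
    exact ⟨cs'.simple j, Subgroup.subset_closure ⟨j, hj, rfl⟩, rfl⟩
  have hsmem := map_mem_finiteContinuation α.symm htmem
  rw [α.symm_apply_apply] at hsmem
  have := Fintype.ofFinite (finiteContinuation (cs.simple a))
  rw [Nat.card_eq_fintype_card, Fintype.two_lt_card_iff]
  refine ⟨1, ⟨_, mem_finiteContinuation_self _⟩, ⟨_, hsmem⟩, ?_, ?_, ?_⟩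
  · exact fun h => hne (congrArg Subtype.val h).symm
  · exact fun h => ht1 (by simpa using (congrArg Subtype.val h).symm)
  · intro h
    apply ha
    have h' : cs.simple a = α.symm t := congrArg Subtype.val h
    rw [h', α.apply_symm_apply]
    exact htref
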